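/- Let $M\ge N\ge 2$, and let $\mathbf H\in\mathbb C^{N\times M}$ have i.i.d. $\mathcal{CN}(0,1)$ entries. Consider $\mathbf y=\mathbf H\mathbf P\mathbf x+\mathbf n$ with $B=N$ streams, $\mathbb E[\mathbf x\mathbf x^H]=\frac{\rho}{N}\mathbf I$ and noise $\mathbf n$ of unit power per component. The precoder is either the regularized zero-forcing precoder $\mathbf P=\beta\,\mathbf H^H(\mathbf H\mathbf H^H+c\,\mathbf I)^{-1}$ with a fixed constant $c>0$, or the matched-filter precoder $\mathbf P=\beta\,\mathbf H^H$, where in both cases $\beta>0$ is chosen so that $\operatorname{tr}(\mathbf P\mathbf P^H)=1$. Let $$\gamma_k(\rho)=\frac{\frac{\rho}{N}|(\mathbf H\mathbf P)_{kk}|^2}{\frac{\rho}{N}\sum_{i\ne k}|(\mathbf H\mathbf P)_{ki}|^2+1},\qquad k=1,\dots,N,$$ be the SINR of stream $k$, and let $P_{\rm out}(\rho,R)=\mathbb P\big(\sum_{k=1}^{N}\log_2(1+\gamma_k(\rho))\le R\big)$ be the outage probability under joint spatial encoding. For a codebook (of any finite size and block length, encoded jointly over the $N$ streams, with average power at most one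 in each stream) let $P_e(\rho)$ be its average error probability, with equiprobable messages and optimal decoding, over the parallel channels $y_k=\sqrt{\gamma_k(\rho)}\,x_k+n_k$, where $n_k$ is i.i.d. $\mathcal{CN}(0,1)$ noise independent of $\mathbf H$, and $\mathbf H$ is constant over a codeword and known to the receiver. A family of codebooks indexed by $\rho$, with rates $R(\rho)$ in bits per channel use, has multiplexing gain $r=\lim_{\rho\to\infty}R(\rho)/\log_2\rho$ and diversity $-\lim_{\rho\to\infty}\log P_e(\rho)/\log\rho$, if these limits exist (the diversity in $[-\infty,\infty]$). The diversity-multiplexing tradeoff (DMT) $d(r)$ is the supremum of the diversities over all families of codebooks with multiplexing gain $r$ that have a diversity. Then, for each of the two precoders and every $0<r\le B=N$: 1. $d(r)=0$. 2. For every rate function $R(\rho)$ with $R(\rho)/\log_2\rho\to r$ there is a constant $\delta>0$ with $P_{\rm out}(\rho,R(\rho))\ge\delta$ for all sufficiently large $\rho$, and $-\lim_{\rho\to\infty}\log P_{\rm out}(\rho,R(\rho))/\log\rho=0$. 3. (Error floor.) For every family of codebooks with multiplexing gain $r$ there is a constant $\delta>0$ such that $P_e(\rho)\ge\delta$ for all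 sufficiently large $\rho$. -/

import Mathlib

open MeasureTheory ProbabilityTheory Filter Topology
open scoped ENNReal NNReal Matrix

noncomputable section

/-- The circularly symmetric complex Gaussian law `CN(0,1)`: independent real and imaginary
parts, each centred of variance `1/2`. -/
def complexGaussian : Measure ℂ :=
  ((gaussianReal 0 (1 / 2)).prod (gaussianReal 0 (1 / 2))).map
    (fun p : ℝ × ℝ => (⟨p.1, p.2⟩ : ℂ))

/-- The product σ-algebra on complex matrices. -/
instance matrixMeasurableSpace (m n : ℕ) : MeasurableSpace (Matrix (Fin m) (Fin n) ℂ) :=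
  inferInstanceAs (MeasurableSpace (Fin m → Fin n → ℂ))

/-- The law of an `m × n` matrix with i.i.d. `CN(0,1)` entries. -/
def gaussianMatrix (m n : ℕ) : Measure (Matrix (Fin m) (Fin n) ℂ) :=
  (Measure.pi fun _ : Fin m => Measure.pi fun _ : Fin n => complexGaussian).map Matrix.of

/-- Scaling of a transmit filter `F` by `β = 1 / √tr(F Fᴴ)`. -/
def normalizePrecoder {M N : ℕ} (F : Matrix (Fin M) (Fin N) ℂ) : Matrix (Fin M) (Fin N) ℂ :=
  ((1 / Real.sqrt (F * Fᴴ).trace.re : ℝ) : ℂ) • F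

/-- Regularized zero-forcing precoder `β Hᴴ (H Hᴴ + c I)⁻¹`. -/
def rzfPrecoder {N M : ℕ} (c : ℝ) (H : Matrix (Fin N) (Fin M) ℂ) : Matrix (Fin M) (Fin N) ℂ :=
  normalizePrecoder (Hᴴ * (H * Hᴴ + (c : ℂ) • (1 : Matrix (Fin N) (Fin N) ℂ))⁻¹)

/-- Transmit matched-filter precoder `β Hᴴ`. -/
def mfPrecoder {N M : ℕ} (H : Matrix (Fin N) (Fin M) ℂ) : Matrix (Fin M) (Fin N) ℂ :=
  normalizePrecoder Hᴴ

/-- SINR of stream `k` for `y = H P x + n` with `E[x xᴴ] = (ρ/N) I`, unit noise power and no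
receive-side equalizer, as a function of the precoding rule `P`, the SNR `ρ` and the channel `H`. -/
def sinr {N M : ℕ} (P : Matrix (Fin N) (Fin M) ℂ → Matrix (Fin M) (Fin N) ℂ) (ρ : ℝ)
    (H : Matrix (Fin N) (Fin M) ℂ) (k : Fin N) : ℝ :=
  (ρ / N * ‖(H * P H) k k‖ ^ 2) /
    (ρ / N * (∑ i ∈ Finset.univ.erase k, ‖(H * P H) k i‖ ^ 2) + 1)

/-- Outage probability under joint spatial encoding at spectral efficiency `R` (bits/s/Hz). -/
def outageProb {N M : ℕ} (P : Matrix (Fin N) (Fin M) ℂ → Matrix (Fin M) (Fin N) ℂ)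
    (ρ R : ℝ) : ℝ≥0∞ :=
  gaussianMatrix N M {H | ∑ k, Real.logb 2 (1 + sinr P ρ H k) ≤ R}

/-- A codebook, encoded jointly over `N` parallel streams and `len` channel uses. A codeword has
its streams as rows; each stream has average power at most one (averaged over the codewords and
over time). -/
structure Codebook (N : ℕ) where
  len : ℕ
  size : ℕ
  len_pos : 0 < len
  size_pos : 0 < size
  codeword : Fin size → Matrix (Fin N) (Fin len) ℂ
  injective : Function.Injective codeword
  power : ∀ k, (∑ m, ∑ t, ‖codeword m k t‖ ^ 2) / ((size : ℝ) * len) ≤ 1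

/-- Rate in bits per channel use. -/
def Codebook.rate {N : ℕ} (C : Codebook N) : ℝ := Real.logb 2 C.size / C.len

/-- The output of the parallel channels `y_k = √γ_k x_k + n_k` over a block. -/
def channelOutput {N l : ℕ} (γ : Fin N → ℝ) (x n : Matrix (Fin N) (Fin l) ℂ) :
    Matrix (Fin N) (Fin l) ℂ :=
  Matrix.of fun k t => ((Real.sqrt (γ k) : ℝ) : ℂ) * x k t + n k t

/-- Average error probability of a codebook with equiprobable messages on the parallel channels
`y_k = √γ_k x_k + n_k` induced by the precoding rule `P` at SNR `ρ`: the channel `H` is constant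
over the block and known to the receiver, the noise is i.i.d. `CN(0,1)`, and decoding is optimal
(the infimum over all measurable decoders). -/
def errorProb {N M : ℕ} (P : Matrix (Fin N) (Fin M) ℂ → Matrix (Fin M) (Fin N) ℂ)
    (ρ : ℝ) (C : Codebook N) : ℝ≥0∞ :=
  ⨅ dec : {f : Matrix (Fin N) (Fin M) ℂ × Matrix (Fin N) (Fin C.len) ℂ → Fin C.size //
      Measurable f},
    (∑ m, ((gaussianMatrix N M).prod (gaussianMatrix N C.len))
      {p | dec.1 (p.1, channelOutput (sinr P ρ p.1) (C.codeword m) p.2) ≠ m}) / (C.size : ℝ≥0∞)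

/-- A rate function, or the rate of a sequence of codebooks, has multiplexing gain
`r = lim R(ρ) / log ρ` (logarithms to base 2). -/
def HasMultiplexingGain (R : ℝ → ℝ) (r : ℝ) : Prop :=
  Tendsto (fun ρ => R ρ / Real.logb 2 ρ) atTop (𝓝 r)

/-- `d = - lim log p(ρ) / log ρ`, as an extended real number (`log 0 = -∞`). -/
def HasDiversity (p : ℝ → ℝ≥0∞) (d : EReal) : Prop :=
  Tendsto (fun ρ => -(ENNReal.log (p ρ) / ((Real.log ρ : ℝ) : EReal))) atTop (𝓝 d)

/-- The diversity-multiplexing tradeoff `d(r)` of a precoding rule: the supremum of the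
diversities over all sequences of codebooks of multiplexing gain `r`. -/
def dmt {N M : ℕ} (P : Matrix (Fin N) (Fin M) ℂ → Matrix (Fin M) (Fin N) ℂ) (r : ℝ) : EReal :=
  sSup {d | ∃ C : ℝ → Codebook N, HasMultiplexingGain (fun ρ => (C ρ).rate) r ∧
    HasDiversity (fun ρ => errorProb P ρ (C ρ)) d}

end

/-! Neither precoder removes interference: signal and interference carry the same factor `ρ/N`, so
each SINR is at most the signal-to-interference ratio, whatever the SNR. At the all-ones channel
both precoders give an effective matrix with all entries equal, so that ratio is `1/(N-1)`. By
continuity all SINRs are at most `2` on an open set `U` of channels, and `U` has positive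
probability because the Gaussian law has full support (`exists_sinr_le_two`). Since `r > 0` forces
the rate to infinity, every channel in `U` is eventually in outage.

For codebooks, a non-asymptotic converse at bounded gains is needed, uniform in block length and
size. Shifting Gaussian noise by `s` turns a set of mass `q` into one of mass at most `exp(‖s‖²) √q`
(`gaussianMatrix_translate_le`). The decision regions have total mass at most `1`, so the sum of
their `√q` is at most `√size`, while the power constraint keeps most shifts small. At large rate,
success probability is therefore at most `3/4` (`sum_success_le`), and averaging over `U` gives the
error floor. A probability bounded below has diversity `0`. -/

/-! ### Change of measure for translated Gaussian noise -/

/-- Translating by `s` changes expectations under `μ` by at most the factor `exp e` times the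
`L²` norm. -/
def TranslationBound {E : Type*} [MeasurableSpace E] [Add E] (μ : Measure E) (s : E) (e : ℝ) :
    Prop :=
  ∀ f : E → ℝ≥0∞, Measurable f →
    ∫⁻ x, f (x + s) ∂μ ≤ ENNReal.ofReal (Real.exp e) * (∫⁻ x, f x ^ (2 : ℝ) ∂μ) ^ (1 / 2 : ℝ)

/-- At variance `1/2` the density `g` is proportional to `exp(-x²)`. Completing the square writes
`g(x - a)` as `exp(a²)` times the geometric mean of `g(x)` and `g(x - 2a)`, and Cauchy–Schwarz then
separates the two factors. -/
theorem translationBound_gaussianReal (a : ℝ) :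
    TranslationBound (gaussianReal 0 (1 / 2)) a (a ^ 2) := by
  intro f hf
  have hv : (1 / 2 : ℝ≥0) ≠ 0 := by norm_num
  set g := gaussianPDF 0 (1 / 2) with hg
  have hgm : Measurable g := measurable_gaussianPDF _ _
  have hpt : ∀ x, g (x - a) =
      ENNReal.ofReal (Real.exp (a ^ 2)) * (g x ^ (1 / 2 : ℝ) * g (x - 2 * a) ^ (1 / 2 : ℝ)) := by
    intro x
    simp only [hg, gaussianPDF]
    rw [ENNReal.ofReal_rpow_of_nonneg (gaussianPDFReal_nonneg _ _ _) (by norm_num),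
      ENNReal.ofReal_rpow_of_nonneg (gaussianPDFReal_nonneg _ _ _) (by norm_num),
      ← ENNReal.ofReal_mul (Real.rpow_nonneg (gaussianPDFReal_nonneg _ _ _) _),
      ← ENNReal.ofReal_mul (Real.exp_nonneg _),
      ← Real.mul_rpow (gaussianPDFReal_nonneg _ _ _) (gaussianPDFReal_nonneg _ _ _),
      ← Real.sqrt_eq_rpow]
    congr 1
    rw [eq_comm, ← Real.sqrt_sq (gaussianPDFReal_nonneg 0 (1 / 2) (x - a)),
      ← Real.sqrt_sq (Real.exp_nonneg (a ^ 2)), ← Real.sqrt_mul (sq_nonneg _)]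
    congr 1
    simp only [gaussianPDFReal]
    push_cast
    simp only [mul_pow, ← Real.exp_nat_mul]
    have : ∀ u p q r s t : ℝ, p + q + r = s + t → 
        Real.exp p * (u * Real.exp q * (u * Real.exp r)) =
          u ^ 2 * (Real.exp (s + t)) := by
      intro u p q r s t h
      rw [← h, Real.exp_add, Real.exp_add]; ring
    rw [this _ _ _ _ _ 0 ?_, add_zero]
    push_cast
    ring
  rw [gaussianReal_of_var_ne_zero _ hv, ← hg,
    lintegral_withDensity_eq_lintegral_mul _ hgm (by fun_prop),
    lintegral_withDensity_eq_lintegral_mul _ hgm (by fun_prop)]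
  have h1 : ∫⁻ x, (g * fun x => f (x + a)) x =
      ENNReal.ofReal (Real.exp (a ^ 2)) *
        ∫⁻ x, ((fun x => f x * g x ^ (1 / 2 : ℝ)) * fun x => g (x - 2 * a) ^ (1 / 2 : ℝ)) x := by
    rw [← lintegral_const_mul _ (by fun_prop)]
    rw [← lintegral_sub_right_eq_self _ a]
    refine lintegral_congr fun x => ?_
    simp only [Pi.mul_apply, sub_add_cancel, hpt]
    ring
  rw [h1]
  gcongr
  refine (ENNReal.lintegral_mul_le_Lp_mul_Lq volume Real.HolderConjugate.two_two
    (by fun_prop) (by fun_prop)).trans ?_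
  have h2 : ∀ t : ℝ≥0∞, (t ^ (1 / 2 : ℝ)) ^ (2 : ℝ) = t := fun t => by
    rw [← ENNReal.rpow_mul]; norm_num
  -- The second Cauchy–Schwarz factor is the total mass of a translated density.
  have h3 : ∫⁻ x, g (x - 2 * a) = 1 := by
    rw [lintegral_sub_right_eq_self g (2 * a)]
    exact lintegral_gaussianPDF_eq_one 0 hv
  simp only [ENNReal.mul_rpow_of_nonneg _ _ zero_le_two, h2, h3, ENNReal.one_rpow, mul_one,
    Pi.mul_apply]
  simp only [mul_comm, le_refl]

/-- Bounding slice by slice in `ν` leaves the `L²` norm of the slice as a new integrand `g` on `E`;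
integrating `g²` restores the full `L²` norm, so the exponents add. This iteration is why the bound
is stated for functions rather than sets. -/
theorem TranslationBound.prod {E F : Type*} [MeasurableSpace E] [Add E] [MeasurableSpace F]
    [Add F] [MeasurableAdd E] [MeasurableAdd F] {μ : Measure E} {ν : Measure F} [SFinite μ]
    [SFinite ν] {s : E} {t : F} {e e' : ℝ} (hμ : TranslationBound μ s e)
    (hν : TranslationBound ν t e') : TranslationBound (μ.prod ν) (s, t) (e + e') := by
  intro f hf
  have hs : Measurable fun x : E × F => f (x + (s, t)) :=
    hf.comp ((measurable_fst.add_const s).prodMk (measurable_snd.add_const t))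
  rw [lintegral_prod _ hs.aemeasurable, lintegral_prod _ (by fun_prop)]
  set g : E → ℝ≥0∞ := fun x => (∫⁻ y, f (x, y) ^ (2 : ℝ) ∂ν) ^ (1 / 2 : ℝ) with hg
  have hgm : Measurable g :=
    (Measurable.lintegral_prod_right' (f := fun p : E × F => f p ^ (2 : ℝ))
      (by fun_prop)).pow_const _
  have h2 : ∀ t : ℝ≥0∞, (t ^ (1 / 2 : ℝ)) ^ (2 : ℝ) = t := fun t => by
    rw [← ENNReal.rpow_mul]; norm_num
  calc ∫⁻ x, ∫⁻ y, f ((x, y) + (s, t)) ∂ν ∂μ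
      ≤ ∫⁻ x, ENNReal.ofReal (Real.exp e') * g (x + s) ∂μ :=
        lintegral_mono fun x => hν (fun y => f (x + s, y)) (by fun_prop)
    _ = ENNReal.ofReal (Real.exp e') * ∫⁻ x, g (x + s) ∂μ :=
        lintegral_const_mul _ (hgm.comp (measurable_add_const s))
    _ ≤ ENNReal.ofReal (Real.exp e') * (ENNReal.ofReal (Real.exp e) *
          (∫⁻ x, g x ^ (2 : ℝ) ∂μ) ^ (1 / 2 : ℝ)) := by
        gcongr; exact hμ g hgm
    _ = _ := by
        simp only [hg, h2]
        rw [← mul_assoc, ← ENNReal.ofReal_mul (Real.exp_nonneg _), ← Real.exp_add, add_comm e' e]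

theorem TranslationBound.of_measurePreserving {E F : Type*} [MeasurableSpace E] [Add E]
    [MeasurableSpace F] [Add F] [MeasurableAdd F] {μ : Measure E} {ν : Measure F}
    {s : E} {e : ℝ} (hμ : TranslationBound μ s e) {φ : E → F} (hφ : MeasurePreserving φ μ ν)
    (hadd : ∀ x, φ (x + s) = φ x + φ s) : TranslationBound ν (φ s) e := by
  intro f hf
  rw [← hφ.lintegral_comp (f := fun x => f (x + φ s)) (hf.comp (measurable_add_const _)),
    ← hφ.lintegral_comp (f := fun x => f x ^ (2 : ℝ)) (by fun_prop)]
  simp only [← hadd]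
  exact hμ (fun x => f (φ x)) (hf.comp hφ.measurable)

theorem TranslationBound.pi {E : Type*} [MeasurableSpace E] [AddMonoid E] [MeasurableAdd E]
    {μ : Measure E} [IsProbabilityMeasure μ] :
    ∀ {n : ℕ} {s : Fin n → E} {e : Fin n → ℝ}, (∀ i, TranslationBound μ (s i) (e i)) →
      TranslationBound (Measure.pi fun _ : Fin n => μ) s (∑ i, e i)
  | 0, s, e, _ => by
    intro f hf
    have : ∀ x : Fin 0 → E, x = s := fun x => Subsingleton.elim _ _
    simp only [this, lintegral_const, measure_univ, mul_one, Finset.univ_eq_empty,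
      Finset.sum_empty, Real.exp_zero, ENNReal.ofReal_one, one_mul, ← ENNReal.rpow_mul]
    norm_num
  | n + 1, s, e, h => by
    have ih := TranslationBound.pi (μ := μ) (n := n) (s := fun i => s i.succ) fun i => h i.succ
    have hp := (h 0).prod ih
    have hmp := (measurePreserving_piFinSuccAbove (fun _ : Fin (n + 1) => μ) 0).symm
    have := hp.of_measurePreserving hmp (fun x => by
      funext i
      refine Fin.cases ?_ (fun j => ?_) i <;> simp [MeasurableEquiv.piFinSuccAbove])
    rw [Fin.sum_univ_succ]
    convert this using 1
    funext i
    refine Fin.cases ?_ (fun j => ?_) i <;> simp [MeasurableEquiv.piFinSuccAbove]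

theorem measurable_complexMk : Measurable fun p : ℝ × ℝ => (⟨p.1, p.2⟩ : ℂ) :=
  Complex.measurableEquivRealProd.symm.measurable

instance isProbabilityMeasure_complexGaussian : IsProbabilityMeasure complexGaussian :=
  Measure.isProbabilityMeasure_map measurable_complexMk.aemeasurable

theorem translationBound_complexGaussian (z : ℂ) :
    TranslationBound complexGaussian z (‖z‖ ^ 2) := by
  have h := ((translationBound_gaussianReal z.re).prod
    (translationBound_gaussianReal z.im)).of_measurePreserving (ν := complexGaussian)
    ⟨measurable_complexMk, rfl⟩ (fun x => rfl)
  rw [Complex.sq_norm, Complex.normSq_apply, ← pow_two, ← pow_two]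
  exact h

theorem measurable_matrixOf (m n : ℕ) :
    Measurable (Matrix.of : (Fin m → Fin n → ℂ) → Matrix (Fin m) (Fin n) ℂ) := measurable_id

instance isProbabilityMeasure_gaussianMatrix (m n : ℕ) :
    IsProbabilityMeasure (gaussianMatrix m n) :=
  Measure.isProbabilityMeasure_map (measurable_matrixOf m n).aemeasurable

instance measurableAdd_matrix (m n : ℕ) : MeasurableAdd (Matrix (Fin m) (Fin n) ℂ) :=
  inferInstanceAs (MeasurableAdd (Fin m → Fin n → ℂ))

theorem translationBound_gaussianMatrix {m n : ℕ} (s : Matrix (Fin m) (Fin n) ℂ) :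
    TranslationBound (gaussianMatrix m n) s (∑ i, ∑ j, ‖s i j‖ ^ 2) :=
  (TranslationBound.pi fun i => TranslationBound.pi fun j =>
    translationBound_complexGaussian (s i j)).of_measurePreserving
    (ν := gaussianMatrix m n) (φ := Matrix.of) ⟨measurable_matrixOf m n, rfl⟩ (fun _ => rfl)

theorem gaussianMatrix_translate_le {m n : ℕ} (s : Matrix (Fin m) (Fin n) ℂ)
    {D : Set (Matrix (Fin m) (Fin n) ℂ)} (hD : MeasurableSet D) :
    (gaussianMatrix m n).real {x | s + x ∈ D} ≤
      Real.exp (∑ i, ∑ j, ‖s i j‖ ^ 2) * √((gaussianMatrix m n).real D) := by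
  have h := translationBound_gaussianMatrix s (D.indicator 1) (measurable_one.indicator hD)
  have h1 : ∫⁻ x, D.indicator (1 : Matrix (Fin m) (Fin n) ℂ → ℝ≥0∞) (x + s) ∂gaussianMatrix m n =
      gaussianMatrix m n {x | s + x ∈ D} := by
    rw [← lintegral_indicator_one (by simp only [add_comm s]; exact measurable_add_const s hD)]
    refine lintegral_congr fun x => ?_
    by_cases hx : s + x ∈ D <;> simp [hx, add_comm x s]
  have h2 : ∫⁻ x, D.indicator (1 : Matrix (Fin m) (Fin n) ℂ → ℝ≥0∞) x ^ (2 : ℝ) ∂gaussianMatrix m n =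
      gaussianMatrix m n D := by
    rw [← lintegral_indicator_one hD]
    refine lintegral_congr fun x => ?_
    by_cases hx : x ∈ D <;> simp [hx]
  rw [h1, h2] at h
  have h3 := ENNReal.toReal_mono (by finiteness) h
  rwa [ENNReal.toReal_mul, ENNReal.toReal_ofReal (Real.exp_nonneg _), ← ENNReal.toReal_rpow,
    ← Real.sqrt_eq_rpow] at h3

/-! ### Full support of the channel law -/

instance borelSpace_matrix (m n : ℕ) : BorelSpace (Matrix (Fin m) (Fin n) ℂ) :=
  inferInstanceAs (BorelSpace (Fin m → Fin n → ℂ))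

instance isOpenPosMeasure_complexGaussian : complexGaussian.IsOpenPosMeasure := by
  have hv : (1 / 2 : ℝ≥0) ≠ 0 := by norm_num
  have : (gaussianReal 0 (1 / 2)).IsOpenPosMeasure :=
    (gaussianReal_absolutelyContinuous' 0 hv).isOpenPosMeasure
  exact Complex.equivRealProdCLM.symm.continuous.isOpenPosMeasure_map
    Complex.equivRealProdCLM.symm.surjective

instance isOpenPosMeasure_gaussianMatrix (m n : ℕ) : (gaussianMatrix m n).IsOpenPosMeasure := by
  have : (Measure.pi fun _ : Fin m => Measure.pi fun _ : Fin n =>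
    complexGaussian).IsOpenPosMeasure := inferInstance
  exact (continuous_id : Continuous (Matrix.of :
    (Fin m → Fin n → ℂ) → Matrix (Fin m) (Fin n) ℂ)).isOpenPosMeasure_map
    Matrix.of.surjective

/-! ### Channels with SINR bounded uniformly in the SNR -/

theorem isUnit_det_gram_add {N M : ℕ} {c : ℝ} (hc : 0 < c) (H : Matrix (Fin N) (Fin M) ℂ) :
    IsUnit (H * Hᴴ + (c : ℂ) • (1 : Matrix (Fin N) (Fin N) ℂ)).det := by
  open scoped ComplexOrder in
  have h : (H * Hᴴ + (c : ℂ) • (1 : Matrix (Fin N) (Fin N) ℂ)).PosDef :=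
    Matrix.PosDef.posSemidef_add (Matrix.posSemidef_self_mul_conjTranspose H)
      (Matrix.PosDef.one.smul (by exact_mod_cast hc))
  exact (Matrix.isUnit_iff_isUnit_det _).1 h.isUnit

theorem continuous_rzfFilter {N M : ℕ} {c : ℝ} (hc : 0 < c) :
    Continuous fun H : Matrix (Fin N) (Fin M) ℂ =>
      Hᴴ * (H * Hᴴ + (c : ℂ) • (1 : Matrix (Fin N) (Fin N) ℂ))⁻¹ := by
  have hA : Continuous fun H : Matrix (Fin N) (Fin M) ℂ =>
      H * Hᴴ + (c : ℂ) • (1 : Matrix (Fin N) (Fin N) ℂ) := by fun_prop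
  refine continuous_id.matrix_conjTranspose.matrix_mul
    (continuous_iff_continuousAt.2 fun H => ContinuousAt.comp ?_ hA.continuousAt)
  refine continuousAt_matrix_inv _ ?_
  rw [Ring.inverse_eq_inv']
  exact continuousAt_inv₀ (isUnit_det_gram_add hc H).ne_zero

/-- Both precoders are normalizations of a continuous filter for which some channel has a constant
nonzero effective channel matrix. -/
theorem exists_filter {N M : ℕ} (hN : 2 ≤ N) (hNM : N ≤ M) {c : ℝ} (hc : 0 < c)
    {P : Matrix (Fin N) (Fin M) ℂ → Matrix (Fin M) (Fin N) ℂ}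
    (hP : P = rzfPrecoder c ∨ P = mfPrecoder) :
    ∃ F : Matrix (Fin N) (Fin M) ℂ → Matrix (Fin M) (Fin N) ℂ, Continuous F ∧
      (P = fun H => normalizePrecoder (F H)) ∧
      ∃ (H : Matrix (Fin N) (Fin M) ℂ) (g : ℂ), g ≠ 0 ∧ ∀ k i, (H * F H) k i = g := by
  have hM0 : (M : ℂ) ≠ 0 := by exact_mod_cast (by omega : M ≠ 0)
  set J : Matrix (Fin N) (Fin M) ℂ := Matrix.of fun _ _ => 1 with hJ
  set K : Matrix (Fin N) (Fin N) ℂ := Matrix.of fun _ _ => 1 with hK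
  have hJJ : J * Jᴴ = (M : ℂ) • K := by
    ext i j; simp [hJ, hK, Matrix.mul_apply]
  have hKK : K * K = (N : ℂ) • K := by
    ext i j; simp [hK, Matrix.mul_apply]
  rcases hP with rfl | rfl
  · have hne : ((M : ℂ) * N + c) ≠ 0 := by
      have : (0 : ℝ) < M * N + c := by positivity
      exact_mod_cast this.ne'
    refine ⟨_, continuous_rzfFilter hc, rfl, J, M / (M * N + c), div_ne_zero hM0 hne, ?_⟩
    have hinv : J * (Jᴴ * (J * Jᴴ + (c : ℂ) • (1 : Matrix (Fin N) (Fin N) ℂ))⁻¹) =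
        ((M : ℂ) / (M * N + c)) • K := by
      -- The regularized Gram matrix is `M • K + c • 1` with `K * K = N • K`, so it acts on `K` as
      -- the scalar `M * N + c`; this avoids computing the inverse.
      have h : ((M : ℂ) / (M * N + c)) • K *
          (J * Jᴴ + (c : ℂ) • (1 : Matrix (Fin N) (Fin N) ℂ)) = J * Jᴴ := by
        rw [Matrix.mul_add, hJJ, Matrix.smul_mul, Matrix.mul_smul, hKK, Matrix.smul_mul,
          Matrix.mul_smul, Matrix.mul_one]
        simp only [smul_smul, ← add_smul]
        congr 1
        field_simp
      rw [← Matrix.mul_assoc]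
      nth_rewrite 1 [← h]
      exact Matrix.mul_nonsing_inv_cancel_right _ _ (isUnit_det_gram_add hc J)
    intro k i
    rw [hinv]; simp [hK]
  · refine ⟨_, continuous_id.matrix_conjTranspose, rfl, J, M, hM0, fun k i => ?_⟩
    change (J * Jᴴ) k i = M
    rw [hJJ]; simp [hK]

theorem sinr_nonneg {N M : ℕ} (P : Matrix (Fin N) (Fin M) ℂ → Matrix (Fin M) (Fin N) ℂ) {ρ : ℝ}
    (hρ : 0 ≤ ρ) (H : Matrix (Fin N) (Fin M) ℂ) (k : Fin N) : 0 ≤ sinr P ρ H k := by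
  unfold sinr
  positivity

/-- The normalization `β²` and `ρ/N` multiply signal and interference alike, so only their ratio
matters. The argument also covers `β = 0`, the default value when the trace vanishes. -/
theorem sinr_normalizePrecoder_le {N M : ℕ}
    {F : Matrix (Fin N) (Fin M) ℂ → Matrix (Fin M) (Fin N) ℂ} {ρ B : ℝ} (hρ : 0 ≤ ρ) (hB : 0 ≤ B)
    {H : Matrix (Fin N) (Fin M) ℂ} {k : Fin N}
    (h : ‖(H * F H) k k‖ ^ 2 ≤ B * ∑ i ∈ Finset.univ.erase k, ‖(H * F H) k i‖ ^ 2) :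
    sinr (fun H => normalizePrecoder (F H)) ρ H k ≤ B := by
  unfold sinr normalizePrecoder
  rw [div_le_iff₀ (by positivity)]
  simp only [Matrix.mul_smul, Matrix.smul_apply, norm_smul, mul_pow, ← Finset.mul_sum]
  generalize ‖(((1 / √(F H * (F H)ᴴ).trace.re : ℝ)) : ℂ)‖ = β
  have h' : ρ / N * β ^ 2 * ‖(H * F H) k k‖ ^ 2 ≤
      ρ / N * β ^ 2 * (B * ∑ i ∈ Finset.univ.erase k, ‖(H * F H) k i‖ ^ 2) := by gcongr
  linarith

theorem measurable_sinr_normalizePrecoder {N M : ℕ}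
    {F : Matrix (Fin N) (Fin M) ℂ → Matrix (Fin M) (Fin N) ℂ} (hF : Continuous F) (ρ : ℝ)
    (k : Fin N) : Measurable fun H => sinr (fun H => normalizePrecoder (F H)) ρ H k := by
  have hG : ∀ i, Measurable fun H : Matrix (Fin N) (Fin M) ℂ => (H * F H) k i := fun i =>
    (Continuous.matrix_elem (continuous_id.matrix_mul hF) k i).measurable
  have ht : Measurable fun H : Matrix (Fin N) (Fin M) ℂ => (F H * (F H)ᴴ).trace.re :=
    (Complex.continuous_re.comp
      (hF.matrix_mul hF.matrix_conjTranspose).matrix_trace).measurable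
  have hβ : Measurable fun H : Matrix (Fin N) (Fin M) ℂ =>
      (((1 / √(F H * (F H)ᴴ).trace.re : ℝ)) : ℂ) :=
    Complex.measurable_ofReal.comp (ht.sqrt.const_div 1)
  have hn : ∀ i, Measurable fun H : Matrix (Fin N) (Fin M) ℂ =>
      ‖(H * normalizePrecoder (F H)) k i‖ ^ 2 := fun i => by
    simp only [normalizePrecoder, Matrix.mul_smul, Matrix.smul_apply, smul_eq_mul]
    exact ((hβ.mul (hG i)).norm).pow_const 2
  exact ((hn k).const_mul _).div
    (((Finset.measurable_sum _ fun i _ => hn i).const_mul _).add_const 1)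

/-- With positive probability all SINRs are bounded by `2`, uniformly in the SNR. -/
theorem exists_sinr_le_two {N M : ℕ} (hN : 2 ≤ N) (hNM : N ≤ M) {c : ℝ} (hc : 0 < c)
    {P : Matrix (Fin N) (Fin M) ℂ → Matrix (Fin M) (Fin N) ℂ}
    (hP : P = rzfPrecoder c ∨ P = mfPrecoder) :
    (∀ ρ k, Measurable fun H => sinr P ρ H k) ∧
    ∃ U, MeasurableSet U ∧ 0 < gaussianMatrix N M U ∧
      ∀ H ∈ U, ∀ ρ, 0 ≤ ρ → ∀ k, sinr P ρ H k ≤ 2 := by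
  obtain ⟨F, hF, rfl, H₀, g, hg, hH₀⟩ := exists_filter hN hNM hc hP
  refine ⟨measurable_sinr_normalizePrecoder hF, ?_⟩
  have hG : ∀ k i, Continuous fun H : Matrix (Fin N) (Fin M) ℂ => (H * F H) k i := fun k i =>
    Continuous.matrix_elem (continuous_id.matrix_mul hF) k i
  have hU : IsOpen {H : Matrix (Fin N) (Fin M) ℂ | ∀ k, ‖(H * F H) k k‖ ^ 2 <
      2 * ∑ i ∈ Finset.univ.erase k, ‖(H * F H) k i‖ ^ 2} := by
    simp only [Set.ofPred_forall]
    exact isOpen_iInter_of_finite fun k => isOpen_lt (by fun_prop) (by fun_prop)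
  refine ⟨_, hU.measurableSet, hU.measure_pos _ ⟨H₀, fun k => ?_⟩, fun H hH ρ hρ k =>
    sinr_normalizePrecoder_le hρ zero_le_two (hH k).le⟩
  -- At `H₀` the strict inequality reads `‖g‖² < 2 (N - 1) ‖g‖²`, which holds as `N ≥ 2`.
  simp only [hH₀, Finset.sum_const, Finset.card_erase_of_mem (Finset.mem_univ k),
    Finset.card_univ, Fintype.card_fin, nsmul_eq_mul]
  have h1 : (1 : ℝ) ≤ (N - 1 : ℕ) := by exact_mod_cast (by omega : 1 ≤ N - 1)
  have h2 : 0 < ‖g‖ ^ 2 := by positivity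
  nlinarith

/-! ### Converse for codebooks on parallel channels of bounded gain -/

theorem measurable_matrix_entry {m n : ℕ} (i : Fin m) (j : Fin n) :
    Measurable fun A : Matrix (Fin m) (Fin n) ℂ => A i j :=
  (continuous_id.matrix_elem i j).measurable

theorem measurable_channelOutput {N l : ℕ} (γ : Fin N → ℝ) (x : Matrix (Fin N) (Fin l) ℂ) :
    Measurable (channelOutput γ x) := by
  refine measurable_pi_lambda _ fun k => measurable_pi_lambda _ fun t => ?_
  exact (measurable_matrix_entry k t).const_add _

theorem sum_sqrt_le {ι : Type*} [Fintype ι] {q : ι → ℝ} (hq : ∀ i, 0 ≤ q i)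
    (h1 : ∑ i, q i ≤ 1) : ∑ i, √(q i) ≤ √(Fintype.card ι) := by
  refine Real.le_sqrt_of_sq_le ((sq_sum_le_card_mul_sum_sq).trans ?_)
  simp only [Real.sq_sqrt (hq _)]
  simpa using mul_le_mul_of_nonneg_left h1 (Nat.cast_nonneg (α := ℝ) (Fintype.card ι))

theorem Codebook.energy_le {N : ℕ} (C : Codebook N) :
    ∑ m, ∑ k, ∑ t, ‖C.codeword m k t‖ ^ 2 ≤ N * (C.size * C.len) := by
  have h0 : (0 : ℝ) < C.size * C.len := by
    have := C.size_pos; have := C.len_pos; positivity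
  rw [Finset.sum_comm]
  calc _ ≤ ∑ _k : Fin N, ((C.size : ℝ) * C.len) := Finset.sum_le_sum fun k _ => by
        have := C.power k
        rwa [div_le_one h0] at this
    _ = _ := by simp

/-- Total success probability of a decoder on parallel channels with bounded gains. -/
theorem sum_success_le {N : ℕ} (hN : 0 < N) (C : Codebook N) {γ : Fin N → ℝ} {B : ℝ} (hB : 0 < B)
    (h0 : ∀ k, 0 ≤ γ k) (hγ : ∀ k, γ k ≤ B)
    {f : Matrix (Fin N) (Fin C.len) ℂ → Fin C.size} (hf : Measurable f) :
    ∑ m, (gaussianMatrix N C.len).real {n | f (channelOutput γ (C.codeword m) n) = m} ≤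
      C.size / 2 + Real.exp (2 * B * N * C.len) * √C.size := by
  have hlen : (0 : ℝ) < C.len := by exact_mod_cast C.len_pos
  have hN' : (0 : ℝ) < N := by exact_mod_cast hN
  set E : Fin C.size → ℝ := fun m => ∑ k, ∑ t, ‖C.codeword m k t‖ ^ 2 with hE
  set q : Fin C.size → ℝ := fun m => (gaussianMatrix N C.len).real (f ⁻¹' {m}) with hq
  have hE0 : ∀ m, 0 ≤ E m := fun m => by simp only [hE]; positivity
  have hq1 : ∑ m, q m ≤ 1 := by
    simp only [hq]
    rw [sum_measureReal_preimage_singleton _ fun m _ => hf (measurableSet_singleton m)]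
    exact measureReal_le_one
  -- The threshold `2 * N * C.len` is twice the bound on the mean codeword energy. Below it the
  -- translation bound applies; above it the first term alone exceeds the trivial bound `1`, as in
  -- Markov's inequality.
  have key : ∀ m, (gaussianMatrix N C.len).real {n | f (channelOutput γ (C.codeword m) n) = m} ≤
      E m / (2 * N * C.len) + Real.exp (2 * B * N * C.len) * √(q m) := by
    intro m
    rcases le_total (E m) (2 * N * C.len) with h | h
    · set s : Matrix (Fin N) (Fin C.len) ℂ :=
        Matrix.of fun k t => ((√(γ k) : ℝ) : ℂ) * C.codeword m k t with hs
      have h1 := gaussianMatrix_translate_le s (hf (measurableSet_singleton m))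
      have h2 : ∑ k, ∑ t, ‖s k t‖ ^ 2 ≤ 2 * B * N * C.len := by
        calc ∑ k, ∑ t, ‖s k t‖ ^ 2 = ∑ k, ∑ t, γ k * ‖C.codeword m k t‖ ^ 2 := by
              simp [hs, mul_pow, Real.sq_sqrt (h0 _)]
          _ ≤ ∑ k, ∑ t, B * ‖C.codeword m k t‖ ^ 2 := by
              gcongr with k _ t _; exact hγ k
          _ = B * E m := by simp only [hE, Finset.mul_sum]
          _ ≤ B * (2 * N * C.len) := by gcongr
          _ = _ := by ring
      have h3 : (gaussianMatrix N C.len).real {n | f (channelOutput γ (C.codeword m) n) = m} ≤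
          Real.exp (2 * B * N * C.len) * √(q m) :=
        h1.trans (mul_le_mul_of_nonneg_right (Real.exp_le_exp.2 h2) (Real.sqrt_nonneg _))
      have := hE0 m
      have : 0 ≤ E m / (2 * N * C.len) := by positivity
      linarith
    · have h1 : 1 ≤ E m / (2 * N * C.len) := (one_le_div (by positivity)).2 h
      have h2 : (gaussianMatrix N C.len).real
        {n | f (channelOutput γ (C.codeword m) n) = m} ≤ 1 := measureReal_le_one
      have h3 : 0 ≤ Real.exp (2 * B * N * C.len) * √(q m) := by positivity
      linarith
  refine (Finset.sum_le_sum fun m _ => key m).trans ?_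
  rw [Finset.sum_add_distrib, ← Finset.sum_div, ← Finset.mul_sum]
  refine add_le_add ?_ ?_
  · rw [div_le_iff₀ (by positivity)]
    exact C.energy_le.trans_eq (by ring)
  · have := sum_sqrt_le (q := q) (fun m => measureReal_nonneg) hq1
    rw [Fintype.card_fin] at this
    gcongr

theorem Codebook.size_ge_of_rate {N : ℕ} (C : Codebook N) {a : ℝ}
    (h : Real.logb 2 (16 * Real.exp a) ≤ C.rate) : 16 * Real.exp (a * C.len) ≤ C.size := by
  have hlen : (0 : ℝ) < C.len := by exact_mod_cast C.len_pos
  have hsize : (0 : ℝ) < C.size := by exact_mod_cast C.size_pos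
  have h1 : (16 * Real.exp a) ^ C.len ≤ C.size := by
    rw [Codebook.rate, le_div_iff₀ hlen, mul_comm, ← Real.logb_pow] at h
    exact (Real.logb_le_logb one_lt_two (by positivity) hsize).1 h
  refine le_trans ?_ h1
  rw [mul_pow, ← Real.exp_nat_mul, mul_comm a]
  gcongr
  exact le_self_pow₀ (by norm_num) C.len_pos.ne'

/-- The rate threshold makes `size ≥ 16 exp(4 B N len)`, so the term `exp(2 B N len) √size` is at
most `size / 4`, on top of the `size / 2` lost to high-energy codewords. -/
theorem sum_success_le_of_rate {N : ℕ} (hN : 0 < N) (C : Codebook N) {γ : Fin N → ℝ} {B : ℝ}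
    (hB : 0 < B) (h0 : ∀ k, 0 ≤ γ k) (hγ : ∀ k, γ k ≤ B)
    (hR : Real.logb 2 (16 * Real.exp (4 * B * N)) ≤ C.rate)
    {f : Matrix (Fin N) (Fin C.len) ℂ → Fin C.size} (hf : Measurable f) :
    ∑ m, (gaussianMatrix N C.len).real {n | f (channelOutput γ (C.codeword m) n) = m} ≤
      3 / 4 * C.size := by
  have h1 := sum_success_le hN C hB h0 hγ hf
  have h2 := C.size_ge_of_rate hR
  have h3 : 4 * Real.exp (2 * B * N * C.len) ≤ √C.size := by
    refine Real.le_sqrt_of_sq_le (le_trans (le_of_eq ?_) h2)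
    rw [mul_pow, ← Real.exp_nat_mul]
    push_cast
    ring_nf
  have h4 : √(C.size : ℝ) * √C.size = C.size := Real.mul_self_sqrt (Nat.cast_nonneg _)
  nlinarith [Real.sqrt_nonneg (C.size : ℝ)]

theorem sum_error_ge_of_rate {N : ℕ} (hN : 0 < N) (C : Codebook N) {γ : Fin N → ℝ} {B : ℝ}
    (hB : 0 < B) (h0 : ∀ k, 0 ≤ γ k) (hγ : ∀ k, γ k ≤ B)
    (hR : Real.logb 2 (16 * Real.exp (4 * B * N)) ≤ C.rate)
    {f : Matrix (Fin N) (Fin C.len) ℂ → Fin C.size} (hf : Measurable f) :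
    (C.size : ℝ≥0∞) / 4 ≤
      ∑ m, gaussianMatrix N C.len {n | f (channelOutput γ (C.codeword m) n) ≠ m} := by
  have h := sum_success_le_of_rate hN C hB h0 hγ hR hf
  have hc : ∀ m, (gaussianMatrix N C.len).real {n | f (channelOutput γ (C.codeword m) n) ≠ m} =
      1 - (gaussianMatrix N C.len).real {n | f (channelOutput γ (C.codeword m) n) = m} :=
    fun m => probReal_compl_eq_one_sub
      ((hf.comp (measurable_channelOutput γ (C.codeword m))) (measurableSet_singleton m))
  have h5 : (C.size : ℝ) / 4 ≤
      ∑ m, (gaussianMatrix N C.len).real {n | f (channelOutput γ (C.codeword m) n) ≠ m} := by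
    simp only [hc, Finset.sum_sub_distrib, Finset.sum_const, Finset.card_univ, Fintype.card_fin,
      nsmul_eq_mul, mul_one]
    linarith
  have h6 := ENNReal.ofReal_le_ofReal h5
  rw [ENNReal.ofReal_sum_of_nonneg fun _ _ => measureReal_nonneg,
    ENNReal.ofReal_div_of_pos (by norm_num)] at h6
  simpa [ofReal_measureReal] using h6

/-- Error floor for all codebooks of large rate. -/
theorem le_errorProb {N M : ℕ} (hN : 0 < N)
    {P : Matrix (Fin N) (Fin M) ℂ → Matrix (Fin M) (Fin N) ℂ} {ρ B : ℝ} (hρ : 0 ≤ ρ) (hB : 0 < B)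
    (hm : ∀ k, Measurable fun H => sinr P ρ H k) {U : Set (Matrix (Fin N) (Fin M) ℂ)}
    (hU : MeasurableSet U) (hUB : ∀ H ∈ U, ∀ k, sinr P ρ H k ≤ B) (C : Codebook N)
    (hR : Real.logb 2 (16 * Real.exp (4 * B * N)) ≤ C.rate) :
    gaussianMatrix N M U / 4 ≤ errorProb P ρ C := by
  refine le_iInf fun ⟨f, hf⟩ => ?_
  have hs0 : (C.size : ℝ≥0∞) ≠ 0 := by exact_mod_cast C.size_pos.ne'
  rw [ENNReal.le_div_iff_mul_le (Or.inl hs0) (Or.inl (by finiteness))]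
  have hout : ∀ m, Measurable fun p : Matrix (Fin N) (Fin M) ℂ × Matrix (Fin N) (Fin C.len) ℂ =>
      f (p.1, channelOutput (sinr P ρ p.1) (C.codeword m) p.2) := by
    intro m
    refine hf.comp (measurable_fst.prodMk ?_)
    refine measurable_pi_lambda _ fun k => measurable_pi_lambda _ fun t => ?_
    have h1 : Measurable fun p : Matrix (Fin N) (Fin M) ℂ × Matrix (Fin N) (Fin C.len) ℂ =>
        p.2 k t := (measurable_matrix_entry k t).comp measurable_snd
    have h2 : Measurable fun p : Matrix (Fin N) (Fin M) ℂ × Matrix (Fin N) (Fin C.len) ℂ =>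
        sinr P ρ p.1 k := (hm k).comp measurable_fst
    exact ((Complex.measurable_ofReal.comp h2.sqrt).mul_const _).add h1
  have hset : ∀ m, MeasurableSet
      {p : Matrix (Fin N) (Fin M) ℂ × Matrix (Fin N) (Fin C.len) ℂ |
        f (p.1, channelOutput (sinr P ρ p.1) (C.codeword m) p.2) ≠ m} := fun m =>
    (hout m (measurableSet_singleton m)).compl
  -- By Fubini the channel is fixed first: the decoder may depend on `H`, and the converse applies
  -- to each section `f (H, ·)`.
  simp only [Measure.prod_apply (hset _)]
  rw [← lintegral_finsetSum _ fun m _ => measurable_measure_prodMk_left (hset m)]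
  calc gaussianMatrix N M U / 4 * C.size
      = ∫⁻ _ in U, (C.size : ℝ≥0∞) / 4 ∂gaussianMatrix N M := by
        rw [setLIntegral_const]; simp only [div_eq_mul_inv]; ring
    _ ≤ ∫⁻ H in U, ∑ m, gaussianMatrix N C.len (Prod.mk H ⁻¹'
          {p | f (p.1, channelOutput (sinr P ρ p.1) (C.codeword m) p.2) ≠ m})
          ∂gaussianMatrix N M :=
        setLIntegral_mono' hU fun H hH => sum_error_ge_of_rate hN C hB
          (sinr_nonneg P hρ H) (hUB H hH) hR (hf.comp measurable_prodMk_left)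
    _ ≤ _ := setLIntegral_le_lintegral _ _

theorem errorProb_le_one {N M : ℕ} (P : Matrix (Fin N) (Fin M) ℂ → Matrix (Fin M) (Fin N) ℂ)
    (ρ : ℝ) (C : Codebook N) : errorProb P ρ C ≤ 1 := by
  refine iInf_le_of_le ⟨fun _ => ⟨0, C.size_pos⟩, measurable_const⟩ ?_
  refine ENNReal.div_le_of_le_mul ?_
  calc _ ≤ ∑ _m : Fin C.size, (1 : ℝ≥0∞) := Finset.sum_le_sum fun m _ => prob_le_one
    _ = _ := by simp

/-! ### Asymptotics in the SNR -/

theorem HasMultiplexingGain.tendsto_atTop {R : ℝ → ℝ} {r : ℝ} (hr : 0 < r)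
    (h : HasMultiplexingGain R r) : Tendsto R atTop atTop := by
  have hl := Real.tendsto_logb_atTop one_lt_two
  refine (Tendsto.pos_mul_atTop hr h hl).congr' ?_
  filter_upwards [hl.eventually_gt_atTop 0] with ρ hρ
  exact div_mul_cancel₀ _ hρ.ne'

/-- Eventually `log p` lies between `log δ` and `0`, so division by `log ρ` sends it to `0`. The
squeeze is done in `ℝ` and transferred to `EReal`, where `p` is eventually nonzero and finite. -/
theorem hasDiversity_zero {p : ℝ → ℝ≥0∞} {δ : ℝ≥0∞} (hδ : 0 < δ)
    (h : ∀ᶠ ρ in atTop, δ ≤ p ρ) (h1 : ∀ ρ, p ρ ≤ 1) : HasDiversity p 0 := by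
  have htop : ∀ ρ, p ρ ≠ ⊤ := fun ρ => ((h1 ρ).trans_lt ENNReal.one_lt_top).ne
  have hδ' : 0 < δ.toReal := by
    obtain ⟨ρ, hρ⟩ := h.exists
    exact ENNReal.toReal_pos hδ.ne' (ne_top_of_le_ne_top (htop ρ) hρ)
  have hreal : Tendsto (fun ρ => -(Real.log (p ρ).toReal / Real.log ρ)) atTop (𝓝 0) := by
    have hlim : Tendsto (fun ρ => -Real.log δ.toReal / Real.log ρ) atTop (𝓝 0) :=
      Real.tendsto_log_atTop.const_div_atTop _
    refine tendsto_of_tendsto_of_tendsto_of_le_of_le' tendsto_const_nhds hlim ?_ ?_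
    · filter_upwards [eventually_gt_atTop 1] with ρ hρ
      rw [← neg_div]
      refine div_nonneg (neg_nonneg.2 (Real.log_nonpos ENNReal.toReal_nonneg ?_))
        (Real.log_pos hρ).le
      exact ENNReal.toReal_mono ENNReal.one_ne_top (h1 ρ)
    · filter_upwards [eventually_gt_atTop 1, h] with ρ hρ hp
      rw [← neg_div]
      refine div_le_div_of_nonneg_right (neg_le_neg ?_) (Real.log_pos hρ).le
      exact Real.log_le_log hδ' (ENNReal.toReal_mono (htop ρ) hp)
  have hE := (continuous_coe_real_ereal.tendsto 0).comp hreal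
  refine hE.congr' ?_
  filter_upwards [h] with ρ hp
  have h0 : p ρ ≠ 0 := (hδ.trans_le hp).ne'
  rw [ENNReal.log_pos_real h0 (htop ρ), ← EReal.coe_div, ← EReal.coe_neg]
  rfl

/-- Block length one and `n` distinct real codewords in the unit interval. -/
noncomputable def equispacedCodebook (N n : ℕ) (hN : 0 < N) (hn : 0 < n) : Codebook N where
  len := 1
  size := n
  len_pos := one_pos
  size_pos := hn
  codeword m := Matrix.of fun _ _ => (m : ℂ) / n
  injective a b hab := by
    have h := congrFun (congrFun hab ⟨0, hN⟩) 0
    have hn' : (n : ℂ) ≠ 0 := by exact_mod_cast hn.ne'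
    simp only [Matrix.of_apply, div_left_inj' hn'] at h
    exact Fin.ext (by exact_mod_cast h)
  power k := by
    have hn' : (0 : ℝ) < n := by exact_mod_cast hn
    rw [div_le_one (by simpa using hn')]
    calc _ ≤ ∑ _m : Fin n, ∑ _t : Fin 1, (1 : ℝ) := by
          refine Finset.sum_le_sum fun m _ => Finset.sum_le_sum fun t _ => ?_
          refine pow_le_one₀ (norm_nonneg _) ?_
          simp only [Matrix.of_apply, norm_div, Complex.norm_natCast]
          exact (div_le_one hn').2 (by exact_mod_cast m.2.le)
      _ = _ := by simp

/-- Ensures that the supremum defining `dmt` is not over the empty set, where it would be `⊥`. -/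
theorem exists_codebook_hasMultiplexingGain {N : ℕ} (hN : 0 < N) {r : ℝ} (hr : 0 < r) :
    ∃ C : ℝ → Codebook N, HasMultiplexingGain (fun ρ => (C ρ).rate) r := by
  refine ⟨fun ρ => equispacedCodebook N (⌈ρ ^ r⌉₊ + 1) hN (Nat.succ_pos _), ?_⟩
  have hl := Real.tendsto_logb_atTop one_lt_two
  -- The `3` comes from `ρ^r ≤ size ≤ ρ^r + 2 ≤ 3 ρ^r` for `ρ > 1`.
  have hlim : Tendsto (fun ρ => r + Real.logb 2 3 / Real.logb 2 ρ) atTop (𝓝 r) := by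
    simpa using (hl.const_div_atTop (Real.logb 2 3)).const_add r
  refine tendsto_of_tendsto_of_tendsto_of_le_of_le' tendsto_const_nhds hlim ?_ ?_ <;>
  filter_upwards [eventually_gt_atTop 1] with ρ hρ
  all_goals
    have hρ0 : 0 < ρ := by linarith
    have hlog : 0 < Real.logb 2 ρ := Real.logb_pos one_lt_two hρ
    have hpow : 1 ≤ ρ ^ r := Real.one_le_rpow hρ.le hr.le
    simp only [Codebook.rate, equispacedCodebook, Nat.cast_one, div_one, Nat.cast_add]
  · rw [le_div_iff₀ hlog, ← Real.logb_rpow_eq_mul_logb_of_pos hρ0]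
    exact Real.logb_le_logb_of_le one_lt_two (by positivity)
      ((Nat.le_ceil _).trans (by linarith))
  · rw [div_le_iff₀ hlog, add_mul, div_mul_cancel₀ _ hlog.ne',
      ← Real.logb_rpow_eq_mul_logb_of_pos hρ0, ← Real.logb_mul (by positivity) (by norm_num)]
    refine Real.logb_le_logb_of_le one_lt_two (by positivity) ?_
    have := Nat.ceil_lt_add_one (zero_le_one.trans hpow)
    linarith

theorem mainTheorem5 (N M : ℕ) (hN : 2 ≤ N) (hNM : N ≤ M) (c : ℝ) (hc : 0 < c)
    (P : Matrix (Fin N) (Fin M) ℂ → Matrix (Fin M) (Fin N) ℂ)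
    (hP : P = rzfPrecoder c ∨ P = mfPrecoder)
    (r : ℝ) (hr : 0 < r) (hrN : r ≤ N) :
    dmt P r = 0 ∧
    (∀ R : ℝ → ℝ, HasMultiplexingGain R r →
      (∃ δ : ℝ≥0∞, 0 < δ ∧ ∀ᶠ ρ in atTop, δ ≤ outageProb P ρ (R ρ)) ∧
      HasDiversity (fun ρ => outageProb P ρ (R ρ)) 0) ∧
    (∀ C : ℝ → Codebook N, HasMultiplexingGain (fun ρ => (C ρ).rate) r →
      ∃ δ : ℝ≥0∞, 0 < δ ∧ ∀ᶠ ρ in atTop, δ ≤ errorProb P ρ (C ρ)) := by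
  have hN0 : 0 < N := by omega
  obtain ⟨hm, U, hU, hpos, hbound⟩ := exists_sinr_le_two hN hNM hc hP
  have floor : ∀ C : ℝ → Codebook N, HasMultiplexingGain (fun ρ => (C ρ).rate) r →
      ∃ δ : ℝ≥0∞, 0 < δ ∧ ∀ᶠ ρ in atTop, δ ≤ errorProb P ρ (C ρ) := by
    intro C hC
    refine ⟨gaussianMatrix N M U / 4, ENNReal.div_pos hpos.ne' (by norm_num), ?_⟩
    filter_upwards [(hC.tendsto_atTop hr).eventually_ge_atTop
      (Real.logb 2 (16 * Real.exp (4 * 2 * N))), eventually_ge_atTop 0] with ρ hρ hρ0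
    exact le_errorProb hN0 hρ0 two_pos (hm ρ) hU (fun H hH => hbound H hH ρ hρ0) _ hρ
  refine ⟨le_antisymm (sSup_le ?_) (le_sSup ?_), fun R hR => ?_, floor⟩
  · rintro d ⟨C, hC, hd⟩
    obtain ⟨δ, hδ, h⟩ := floor C hC
    exact (tendsto_nhds_unique hd
      (hasDiversity_zero hδ h fun ρ => errorProb_le_one P ρ (C ρ))).le
  · obtain ⟨C, hC⟩ := exists_codebook_hasMultiplexingGain hN0 hr
    obtain ⟨δ, hδ, h⟩ := floor C hC
    exact ⟨C, hC, hasDiversity_zero hδ h fun ρ => errorProb_le_one P ρ (C ρ)⟩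
  · have h : ∀ᶠ ρ in atTop, gaussianMatrix N M U ≤ outageProb P ρ (R ρ) := by
      -- On `U` each stream contributes at most `log₂ (1 + 2)`.
      filter_upwards [(hR.tendsto_atTop hr).eventually_ge_atTop (N * Real.logb 2 3),
        eventually_ge_atTop 0] with ρ hρ hρ0
      refine measure_mono fun H hH => le_trans ?_ hρ
      calc ∑ k, Real.logb 2 (1 + sinr P ρ H k) ≤ ∑ _k : Fin N, Real.logb 2 3 := by
            refine Finset.sum_le_sum fun k _ => ?_
            have h0 := sinr_nonneg P hρ0 H k
            have h2 := hbound H hH ρ hρ0 k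
            exact Real.logb_le_logb_of_le one_lt_two (by linarith) (by linarith)
        _ = N * Real.logb 2 3 := by simp
    exact ⟨⟨_, hpos, h⟩, hasDiversity_zero hpos h fun ρ => prob_le_one⟩
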